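/- **Model.** A synchronous network on the node set $V=\{1,\dots,n\}$ with node weights $w:V\to\{1,\dots,W\}$, where $W$ is polynomial in $n$, starts as the empty graph. An adversary changes it by inserting and deleting arbitrarily many edges in every round: $G_i=(V,E_i)$ is the graph at the beginning of round $i\ge 0$ (after the changes of round $i$), and the changes of round $i$ are the edges of $E_{i-1}\oplus E_i$, with $E_{-1}=\emptyset$. A deterministic distributed algorithm has each node start with its id, its weight and $n$. In each round a node first learns its current neighbours and which of its edges have just been changed (a posteriori indications), computes locally, sends a message of $O(\log n)$ bits to each current neighbour, receives its neighbours' messages, and computes locally. **Labels.** Every node $v$ stores a label, an array $L_v[u]$, $u\in V$, of real numbers: $L_v[u]$ is the dual weight of the edge $\{v,u\}$, and $L_v[v]$ is the remaining weight of $v$. With respect to a graph $G=(V,E)$, the star of $v$ is *consistent* if all $L_v[u]\ge 0$; $L_v[u]=0$ for every $u\ne v$ that is not a neighbour of $v$; $\sum_{u\in V}L_v[u]=w(v)$; $L_v[u]=L_u[v]$ for every neighbour $u$ of $v$; and $L_v[v]=0$ or $L_u[u]=0$ for all neighbours $u$ of $v$. A round $i$ is *consistent* if, for the labels held at the beginning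 of round $i$, all stars are consistent with respect to $G_i$. Let $\mathrm{incorrect}(i)$ be the number of rounds among $0,\dots,i$ that are not consistent, and let $\mathrm{changes}(i)$ be the number of edge insertions and deletions in rounds $0,\dots,i$. **Lemma.** There are a deterministic distributed algorithm and an absolute constant $K$ such that, for all such weights (with the constant in the $O(\log n)$ message bound depending only on the polynomial that bounds $W$), all $n$, and every sequence of edge insertions and deletions: 1. all messages have $O(\log n)$ bits, and the initial labels are consistent for the empty graph; 2. the amortized round complexity is at most $K$, that is, $O(1)$: $\mathrm{incorrect}(i)/\mathrm{changes}(i)\le K$ for every $i$ with $\mathrm{changes}(i)>0$; 3. in every consistent round $i$, the function $\delta(\{u,v\})=L_u[v]=L_v[u]$ on $E_i$ is a valid dual solution, that is, $\delta\ge 0$ and $\sum_{e\in E_i:\,v\in e}\delta(e)\le w(v)$ for all $v$; the set of nodes whose constraint is tight is $S=\{v: L_v[v]=0\}$; and $S$ is a vertex cover of $G_i$ whose weight is at most twice the minimum weight of a vertex cover of $G_i$. -/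

import Mathlib

/-! ### Minimum weight vertex cover and its dual -/

section Cover

variable {V : Type} [Fintype V]

open scoped Classical in
/-- The total dual weight `∑_{e ∈ E, v ∈ e} δ(e)` of the edges that touch `v`. -/
noncomputable def dualLoad (G : SimpleGraph V) (δ : Sym2 V → ℝ) (v : V) : ℝ :=
  ∑ e ∈ Finset.univ.filter (fun e : Sym2 V => e ∈ G.edgeSet ∧ v ∈ e), δ e

/-- `δ` is a `G`-valid dual weight function (only its values on the edges of `G` matter). -/
def IsGValid (G : SimpleGraph V) (w : V → ℝ) (δ : Sym2 V → ℝ) : Prop :=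
  (∀ e ∈ G.edgeSet, 0 ≤ δ e) ∧ ∀ v, dualLoad G δ v ≤ w v

open scoped Classical in
/-- The set `S_δ` of nodes whose dual constraint is tight. -/
noncomputable def tightNodes (G : SimpleGraph V) (w : V → ℝ) (δ : Sym2 V → ℝ) : Finset V :=
  Finset.univ.filter (fun v => w v ≤ dualLoad G δ v)

/-- `S` is a vertex cover of `G` of weight at most twice the weight of every vertex cover. -/
def IsTwoApproxMWVC (G : SimpleGraph V) (w : V → ℝ) (S : Finset V) : Prop :=
  G.IsVertexCover (S : Set V) ∧
    ∀ C : Finset V, G.IsVertexCover (C : Set V) → ∑ v ∈ S, w v ≤ 2 * ∑ v ∈ C, w v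

/-- The star centred at `v` is consistently labelled. The label of a node `v` is an array `L v`
indexed by the nodes: `L v u` is the dual weight of the edge `{v, u}` (and `0` if there is no such
edge), and `L v v` is the remaining weight of `v`. -/
structure StarConsistent (G : SimpleGraph V) (w : V → ℝ) (L : V → V → ℝ) (v : V) : Prop where
  nonneg : ∀ u, 0 ≤ L v u
  eq_zero_of_not_adj : ∀ u, u ≠ v → ¬ G.Adj v u → L v u = 0
  sum_eq : ∑ u, L v u = w v
  reciprocal : ∀ u, G.Adj v u → L v u = L u v
  covered : L v v = 0 ∨ ∀ u, G.Adj v u → L u u = 0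

/-- The labelling is globally consistent: all stars are. -/
def LabelingConsistent (G : SimpleGraph V) (w : V → ℝ) (L : V → V → ℝ) : Prop :=
  ∀ v, StarConsistent G w L v

open scoped Classical in
/-- The set of nodes that a labelling selects: those whose remaining weight is zero. -/
noncomputable def selectedNodes (L : V → V → ℝ) : Finset V :=
  Finset.univ.filter (fun v => L v v = 0)

end Cover

/-! ### Deterministic distributed algorithms in a dynamic synchronous network -/

/-- A deterministic algorithm for a dynamic synchronous network on the node set `Fin n`.
All nodes run the same code, and the algorithm may depend on `n`.
* `init v x` is the initial state of the node with id `v` and weight `x`.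
* At the beginning of every round a node is given its current set of neighbours, and its
  indications (the set of nodes `u` such that its edge to `u` was inserted or deleted since the
  previous round); it performs local computation (`observe`).
* It then sends to each neighbour `u` the bit string `send s u` (the empty string is silence).
* It then receives the messages of its neighbours (`none` from a non-neighbour) and performs local
  computation (`receive`).
* `label` reads off the label (an array indexed by the nodes) that the node stores. -/
structure DynamicAlgorithm (n : ℕ) where
  State : Type
  init : Fin n → ℕ → State
  observe : State → Finset (Fin n) → Finset (Fin n) → State
  send : State → Fin n → List Bool
  receive : State → (Fin n → Option (List Bool)) → State
  label : State → Fin n → ℝ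

section Dynamics

variable {n : ℕ}

/-- The graph just before the changes of round `i`: the network starts as the empty graph, and
`G i` is the graph at the beginning of round `i`, after the changes that are indicated to the nodes
in that round. -/
def graphBefore (G : ℕ → SimpleGraph (Fin n)) : ℕ → SimpleGraph (Fin n)
  | 0 => ⊥
  | i + 1 => G i

/-- The set of edges that are inserted or deleted in round `i`. -/
def changedEdges (G : ℕ → SimpleGraph (Fin n)) (i : ℕ) : Set (Sym2 (Fin n)) :=
  symmDiff (graphBefore G i).edgeSet (G i).edgeSet

/-- The number of topology changes in rounds `0, …, i`. -/
noncomputable def changes (G : ℕ → SimpleGraph (Fin n)) (i : ℕ) : ℕ :=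
  ∑ j ∈ Finset.range (i + 1), (changedEdges G j).ncard

open scoped Classical in
/-- The neighbours of `v` in round `i`. -/
noncomputable def nbrs (G : ℕ → SimpleGraph (Fin n)) (i : ℕ) (v : Fin n) : Finset (Fin n) :=
  Finset.univ.filter (fun u => (G i).Adj v u)

open scoped Classical in
/-- The indications of `v` at the beginning of round `i`. -/
noncomputable def indications (G : ℕ → SimpleGraph (Fin n)) (i : ℕ) (v : Fin n) :
    Finset (Fin n) :=
  Finset.univ.filter (fun u => s(v, u) ∈ changedEdges G i)

namespace DynamicAlgorithm

/-- The state of a node after it has processed the indications of round `i`, given the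
states `σ` of all nodes at the beginning of that round. -/
noncomputable def observed (A : DynamicAlgorithm n) (G : ℕ → SimpleGraph (Fin n)) (i : ℕ)
    (σ : Fin n → A.State) (v : Fin n) : A.State :=
  A.observe (σ v) (nbrs G i v) (indications G i v)

open scoped Classical in
/-- The state of `v` at the beginning of round `i`, before it receives its indications. -/
noncomputable def state (A : DynamicAlgorithm n) (w : Fin n → ℕ) (G : ℕ → SimpleGraph (Fin n)) :
    ℕ → Fin n → A.State
  | 0 => fun v => A.init v (w v)
  | i + 1 => fun v =>
      A.receive (A.observed G i (A.state w G i) v)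
        (fun u => if (G i).Adj u v then some (A.send (A.observed G i (A.state w G i) u) v)
          else none)

/-- The labelling at the beginning of round `i`. -/
noncomputable def labeling (A : DynamicAlgorithm n) (w : Fin n → ℕ)
    (G : ℕ → SimpleGraph (Fin n)) (i : ℕ) : Fin n → Fin n → ℝ :=
  fun v => A.label (A.state w G i v)

/-- The message that `u` sends to its neighbour `v` in round `i`. -/
noncomputable def message (A : DynamicAlgorithm n) (w : Fin n → ℕ)
    (G : ℕ → SimpleGraph (Fin n)) (i : ℕ) (u v : Fin n) : List Bool :=
  A.send (A.observed G i (A.state w G i) u) v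

/-- In round `i` there is no inconsistent star. -/
def ConsistentAt (A : DynamicAlgorithm n) (w : Fin n → ℕ) (G : ℕ → SimpleGraph (Fin n))
    (i : ℕ) : Prop :=
  LabelingConsistent (G i) (fun v => (w v : ℝ)) (A.labeling w G i)

open scoped Classical in
/-- The number of rounds among `0, …, i` in which there is at least one inconsistent star. -/
noncomputable def incorrect (A : DynamicAlgorithm n) (w : Fin n → ℕ)
    (G : ℕ → SimpleGraph (Fin n)) (i : ℕ) : ℕ :=
  ((Finset.range (i + 1)).filter (fun j => ¬ A.ConsistentAt w G j)).card

end DynamicAlgorithm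

end Dynamics

/-! ### Consistent labellings are dual solutions with a 2-approximate tight set -/

section Static

variable {V : Type} [Fintype V] {G : SimpleGraph V} {w : V → ℝ} {L : V → V → ℝ}

/-! The static half is linear programming duality. In a consistent labelling the labels off the
diagonal are a feasible dual and the remaining weights are its slacks. On every edge one endpoint
has slack zero, so the tight nodes form a cover. Each edge pays its dual weight at most twice there,
and at least once in any other cover, which gives the factor two
(`LabelingConsistent.isTwoApproxMWVC`).

The dynamic half maintains such a dual. When an edge changes, its dual weight returns to its
endpoints, which become dirty; only edges with a dirty endpoint may then be uncovered. Rounds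
alternate: in even rounds the nodes announce dirtiness and remaining weight, in odd rounds each node
grants the smallest dirty node it knows of in its closed neighbourhood. A node that grants itself
offers its remaining weight greedily to its neighbours, and an offer counts only if the neighbour
grants it. If all neighbours do, either the node's own weight is exhausted or every announced demand
is met, so its edges are covered and it is clean (`rest_exchange_of_repairs`).

Changes between announcement and repair are harmless: announcements over changed edges are
forgotten, and any other outdated announcement comes from a node that is now dirty and whose
remaining weight has not dropped (`HeardValid`). Thus `Invariant` always holds.

For the amortization, a change dirties at most two nodes and a repair never dirties any. In an odd
round without changes the globally smallest dirty node obtains every grant it needs, so the dirty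
set shrinks. A potential of about twice the number of dirty nodes then pays for the inconsistent
rounds (`ite_add_potential_succ_le`). -/

theorem LabelingConsistent.symm (h : LabelingConsistent G w L) {u v : V} (huv : u ≠ v) :
    L v u = L u v := by
  by_cases ha : G.Adj v u
  · exact (h v).reciprocal u ha
  · rw [(h v).eq_zero_of_not_adj u huv ha,
      (h u).eq_zero_of_not_adj v huv.symm fun h' => ha h'.symm]

open scoped Classical in
theorem LabelingConsistent.sum_erase (h : LabelingConsistent G w L) (v : V) :
    ∑ u ∈ Finset.univ.erase v, L v u = w v - L v v := by
  rw [← (h v).sum_eq, ← Finset.add_sum_erase _ _ (Finset.mem_univ v)]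
  ring

/-- The edge weights given by a labelling: the mean of the labels of the two endpoints. -/
noncomputable def edgeWeight (L : V → V → ℝ) : Sym2 V → ℝ :=
  Sym2.lift ⟨fun u v => (L u v + L v u) / 2, fun _ _ => congrArg (· / 2) (add_comm _ _)⟩

theorem LabelingConsistent.edgeWeight_mk (h : LabelingConsistent G w L) {u v : V} (huv : u ≠ v) :
    edgeWeight L s(u, v) = L u v := by
  simp only [edgeWeight, Sym2.lift_mk]
  rw [h.symm huv]
  ring

open scoped Classical in
theorem dualLoad_eq_sum_adj (G : SimpleGraph V) (δ : Sym2 V → ℝ) (v : V) :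
    dualLoad G δ v = ∑ u ∈ Finset.univ.filter (fun u => G.Adj v u), δ s(v, u) := by
  unfold dualLoad
  refine (Finset.sum_bij (fun u _ => s(v, u)) ?_ ?_ ?_ ?_).symm
  · intro u hu
    simpa using hu
  · intro a _ b _ hab
    exact Sym2.congr_right.1 hab
  · intro e he
    obtain ⟨he, hv⟩ := (Finset.mem_filter.1 he).2
    obtain ⟨u, rfl⟩ := Sym2.mem_iff_exists.1 hv
    exact ⟨u, by simpa using he, rfl⟩
  · intros
    rfl

theorem LabelingConsistent.dualLoad_edgeWeight (h : LabelingConsistent G w L) (v : V) :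
    dualLoad G (edgeWeight L) v = w v - L v v := by
  classical
  rw [dualLoad_eq_sum_adj, ← h.sum_erase]
  rw [Finset.sum_congr rfl (g := fun u => L v u)]
  · refine Finset.sum_subset (fun u hu => ?_) fun u hu hu' => ?_
    · simpa using (Finset.mem_filter.1 hu).2.ne.symm
    · exact (h v).eq_zero_of_not_adj u (Finset.ne_of_mem_erase hu) (by simpa using hu')
  · intro u hu
    exact h.edgeWeight_mk (Finset.mem_filter.1 hu).2.ne

theorem LabelingConsistent.isGValid (h : LabelingConsistent G w L) :
    IsGValid G w (edgeWeight L) := by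
  refine ⟨fun e he => ?_, fun v => ?_⟩
  · induction e with
    | _ u v =>
      rw [h.edgeWeight_mk (SimpleGraph.Adj.ne he)]
      exact (h u).nonneg v
  · rw [h.dualLoad_edgeWeight]
    linarith [(h v).nonneg v]

theorem LabelingConsistent.tightNodes_eq (h : LabelingConsistent G w L) :
    tightNodes G w (edgeWeight L) = selectedNodes L := by
  ext v
  simp only [tightNodes, selectedNodes, Finset.mem_filter, Finset.mem_univ, true_and,
    h.dualLoad_edgeWeight]
  have := (h v).nonneg v
  constructor <;> intro h' <;> linarith

/-- Weak duality in double-counted form. The matrix `D` of labels with the diagonal removed is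
symmetric and supported on edges. The rows of selected nodes sum to their full weights, and every
nonzero entry has its row or its column in `C`. -/
theorem LabelingConsistent.isTwoApproxMWVC (h : LabelingConsistent G w L) :
    IsTwoApproxMWVC G w (selectedNodes L) := by
  classical
  refine ⟨fun u v huv => ?_, fun C hC => ?_⟩
  · simp only [selectedNodes, Finset.coe_filter, Finset.mem_univ, true_and, Set.mem_ofPred_eq]
    exact (h u).covered.imp id fun h' => h' v huv
  set D : V → V → ℝ := fun v u => if u = v then 0 else L v u with hD
  have hD0 : ∀ v u, 0 ≤ D v u := fun v u => by
    simp only [hD]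
    split_ifs
    exacts [le_rfl, (h v).nonneg u]
  have hDsymm : ∀ v u, D v u = D u v := fun v u => by
    simp only [hD, eq_comm (a := u) (b := v)]
    split_ifs with huv
    exacts [rfl, h.symm (Ne.symm huv)]
  have hDsum : ∀ v, ∑ u, D v u = w v - L v v := fun v => by
    rw [← h.sum_erase, ← Finset.add_sum_erase _ _ (Finset.mem_univ v)]
    simp only [hD, if_true, zero_add]
    exact Finset.sum_congr rfl fun u hu => if_neg (Finset.ne_of_mem_erase hu)
  calc ∑ v ∈ selectedNodes L, w v = ∑ v ∈ selectedNodes L, ∑ u, D v u := by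
        refine Finset.sum_congr rfl fun v hv => ?_
        rw [hDsum, (Finset.mem_filter.1 hv).2, sub_zero]
    _ ≤ ∑ v, ∑ u, D v u :=
        Finset.sum_le_sum_of_subset_of_nonneg (Finset.subset_univ _) fun v _ _ =>
          Finset.sum_nonneg fun u _ => hD0 v u
    _ ≤ ∑ v, ∑ u, ((if v ∈ C then D v u else 0) + (if u ∈ C then D v u else 0)) := by
        refine Finset.sum_le_sum fun v _ => Finset.sum_le_sum fun u _ => ?_
        have := hD0 v u
        by_cases ha : G.Adj v u
        · rcases hC ha with h' | h'
          · rw [if_pos (Finset.mem_coe.1 h')]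
            split_ifs <;> linarith
          · rw [if_pos (Finset.mem_coe.1 h')]
            split_ifs <;> linarith
        · have h0 : D v u = 0 := by
            simp only [hD]
            split_ifs with huv
            exacts [rfl, (h v).eq_zero_of_not_adj u huv ha]
          simp [h0]
    _ = 2 * ∑ v ∈ C, ∑ u, D v u := by
        simp only [Finset.sum_add_distrib]
        rw [Finset.sum_comm (f := fun v u => if u ∈ C then D v u else 0)]
        have h1 : ∑ v, ∑ u, (if v ∈ C then D v u else 0) = ∑ v ∈ C, ∑ u, D v u := by
          rw [← Finset.sum_filter_add_sum_filter_not Finset.univ (· ∈ C)]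
          rw [Finset.sum_eq_zero (s := Finset.univ.filter (¬ · ∈ C)), add_zero]
          · refine Finset.sum_congr (by simp) fun v hv => ?_
            simp [hv]
          · intro v hv
            simp [(Finset.mem_filter.1 hv).2]
        have h2 : ∑ y, ∑ x, (if y ∈ C then D x y else 0) = ∑ v ∈ C, ∑ u, D v u := by
          rw [← h1]
          exact Finset.sum_congr rfl fun y _ => Finset.sum_congr rfl fun x _ => by
            rw [hDsymm]
        rw [h1, h2]
        ring
    _ ≤ 2 * ∑ v ∈ C, w v := by
        gcongr with v hv
        rw [hDsum]
        linarith [(h v).nonneg v]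

end Static

/-! ### Encoding of messages -/

/-- A message consists of a flag and a number in binary. -/
def encodeMessage (x : Bool × ℕ) : List Bool :=
  x.1 :: x.2.bits

/-- The inverse of `encodeMessage`. -/
def decodeMessage : List Bool → Bool × ℕ
  | [] => (false, 0)
  | b :: l => (b, l.foldr Nat.bit 0)

theorem foldr_bit_bits (k : ℕ) : k.bits.foldr Nat.bit 0 = k := by
  induction k using Nat.binaryRec' with
  | zero => simp
  | bit b n h ih => rw [Nat.bits_append_bit n b h, List.foldr_cons, ih]

@[simp]
theorem decodeMessage_encodeMessage (x : Bool × ℕ) : decodeMessage (encodeMessage x) = x := by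
  simp [encodeMessage, decodeMessage, foldr_bit_bits]

theorem length_encodeMessage_le {x : Bool × ℕ} {m : ℕ} (h : x.2 ≤ m) :
    (encodeMessage x).length ≤ m.size + 1 := by
  simpa [encodeMessage, Nat.size_eq_bits_len] using Nat.size_le_size h

theorem exists_size_eval_le_mul_log (p : Polynomial ℕ) :
    ∃ B : ℕ, ∀ n, 2 ≤ n → (p.eval n).size + 1 ≤ B * Nat.log 2 n := by
  refine ⟨(p.eval 1).size + 2 * p.natDegree + 1, fun n hn => ?_⟩
  have hlog : 1 ≤ Nat.log 2 n := Nat.log_pos (by norm_num) hn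
  -- Since `n ≥ 2`, the logarithm is at least one and absorbs the rounding: `log + 1 ≤ 2 * log`.
  have hn' : n < 2 ^ (2 * Nat.log 2 n) :=
    (Nat.lt_pow_succ_log_self (by norm_num) n).trans_le
      (Nat.pow_le_pow_right (by norm_num) (by omega))
  have h1 : p.eval n ≤ p.eval 1 * n ^ p.natDegree := by
    rw [Polynomial.eval_eq_sum_range, Polynomial.eval_eq_sum_range, Finset.sum_mul]
    refine Finset.sum_le_sum fun i hi => ?_
    rw [one_pow, mul_one]
    exact Nat.mul_le_mul_left _ (Nat.pow_le_pow_right (by omega)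
      (Nat.lt_succ_iff.1 (Finset.mem_range.1 hi)))
  have h2 : (p.eval n).size ≤ (p.eval 1).size + 2 * Nat.log 2 n * p.natDegree := by
    rw [Nat.size_le, pow_add, pow_mul]
    refine h1.trans_lt ?_
    exact Nat.mul_lt_mul_of_lt_of_le (Nat.lt_size_self _)
      (Nat.pow_le_pow_left hn'.le _) (by positivity)
  nlinarith

/-! ### Greedy allocation -/

section Greedy

variable {n : ℕ}

/-- The part of a budget `R` that is left to `k` when the demands `ρ` are served in the order of
the ids. -/
def greedyShare (ρ : Fin n → ℕ) (R : ℕ) (k : Fin n) : ℕ :=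
  min (∑ j ∈ Finset.Iic k, ρ j) R - min (∑ j ∈ Finset.Iio k, ρ j) R

theorem greedyShare_le (ρ : Fin n → ℕ) (R : ℕ) (k : Fin n) : greedyShare ρ R k ≤ ρ k := by
  have : ∑ j ∈ Finset.Iic k, ρ j = ρ k + ∑ j ∈ Finset.Iio k, ρ j := by
    rw [← Finset.Iio_insert, Finset.sum_insert (by simp)]
  unfold greedyShare
  omega

/-- The shares are the increments of the truncated partial sums of the demands, so their sum
telescopes. -/
theorem sum_greedyShare (ρ : Fin n → ℕ) (R : ℕ) :
    ∑ k, greedyShare ρ R k = min (∑ k, ρ k) R := by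
  set g : ℕ → ℕ := fun m => min (∑ j ∈ Finset.univ.filter (fun j : Fin n => j.val < m), ρ j) R
    with hg
  have hmono : Monotone g := fun a b hab =>
    min_le_min_right _ <| Finset.sum_le_sum_of_subset fun j hj => by
      simp only [Finset.mem_filter, Finset.mem_univ, true_and] at hj ⊢
      omega
  have h1 : ∀ k : Fin n, greedyShare ρ R k = g (k + 1) - g k := fun k => by
    simp only [greedyShare, hg]
    congr 4 <;> ext j
    · simp only [Finset.mem_Iic, Finset.mem_filter, Finset.mem_univ, true_and, Fin.le_def,
        Nat.lt_succ_iff]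
    · simp only [Finset.mem_Iio, Finset.mem_filter, Finset.mem_univ, true_and, Fin.lt_def]
  rw [Finset.sum_congr rfl fun k _ => h1 k,
    Fin.sum_univ_eq_sum_range (fun k => g (k + 1) - g k), Finset.sum_range_tsub hmono]
  simp [hg]

theorem sum_greedyShare_le (ρ : Fin n → ℕ) (R : ℕ) : ∑ k, greedyShare ρ R k ≤ R := by
  rw [sum_greedyShare]
  exact min_le_right _ _

/-- If the budget is not exhausted, the truncation never acts: the shares sum to the total demand,
and a termwise inequality with equal sums is an equality. -/
theorem greedyShare_eq_of_sum_lt {ρ : Fin n → ℕ} {R : ℕ} (h : ∑ k, greedyShare ρ R k < R)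
    (k : Fin n) : greedyShare ρ R k = ρ k := by
  have h1 : ∑ k, greedyShare ρ R k = ∑ k, ρ k := by
    rw [sum_greedyShare] at h ⊢
    omega
  exact (Finset.sum_eq_sum_iff_of_le fun k _ => greedyShare_le ρ R k).1 h1 k (Finset.mem_univ k)

end Greedy

/-! ### The repair algorithm -/

namespace DualRepair

variable {n : ℕ}

/-- The state of a node.
* `lab` is the label of the node, with the remaining weight at index `id`.
* `dirty` says that the edges of the node have changed since its last repair.
* `phase` is the parity of the round: in even rounds all nodes announce their dirty bit and their
  remaining weight, in odd rounds repairs take place.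
* `heard u` is the announcement of `u`, if it was made over an edge that has not changed since. -/
structure NodeState (n : ℕ) where
  id : Fin n
  lab : Fin n → ℕ
  dirty : Bool
  phase : Bool
  heard : Fin n → Option (Bool × ℕ)

/-- The remaining weight of a node. -/
def NodeState.rest (s : NodeState n) : ℕ :=
  s.lab s.id

/-- `u` is a dirty node in the closed neighbourhood of the node, as far as the node knows. -/
def Asks (s : NodeState n) (u : Fin n) : Prop :=
  (u = s.id ∧ s.dirty = true) ∨ ∃ r, s.heard u = some (true, r)

/-- The node permits `u`, the smallest dirty node in its closed neighbourhood, to repair. -/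
def Grants (s : NodeState n) (u : Fin n) : Prop :=
  Asks s u ∧ ∀ x, Asks s x → u ≤ x

/-- The remaining weight of `u` as announced. -/
def demand (s : NodeState n) (u : Fin n) : ℕ :=
  ((s.heard u).map Prod.snd).getD 0

open scoped Classical in
/-- The dual weight by which the node offers to raise the edge to `u`. -/
noncomputable def share (s : NodeState n) (u : Fin n) : ℕ :=
  if Grants s s.id then greedyShare (demand s) s.rest u else 0

open scoped Classical in
/-- The content of the message to `u`. -/
noncomputable def content (s : NodeState n) (u : Fin n) : Bool × ℕ :=
  if s.phase then (decide (Grants s u), share s u) else (s.dirty, s.rest)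

open scoped Classical in
/-- The increase of the dual weight of the edge to `u`, given the received messages. -/
noncomputable def gain (s : NodeState n) (m : Fin n → Option (Bool × ℕ)) (u : Fin n) : ℕ :=
  match m u with
  | none => 0
  -- An offer counts only if its receiver grants the offering node. The first summand is the node's
  -- own offer, accepted by `u` through the flag `b`; the second is the offer of `u`, accepted here.
  | some (b, k) => (if b then share s u else 0) + (if Grants s u then k else 0)

/-- The node repairs its star: it and all its neighbours have granted this. -/
def Repairs (s : NodeState n) (m : Fin n → Option (Bool × ℕ)) : Prop :=
  Grants s s.id ∧ ∀ u x, m u = some x → x.1 = true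

/-- The initial state. -/
def start (v : Fin n) (x : ℕ) : NodeState n where
  id := v
  lab := fun u => if u = v then x else 0
  dirty := false
  phase := false
  heard := fun _ => none

/-- The dual weight of the changed edges returns to the node, which becomes dirty. -/
def observe (s : NodeState n) (I : Finset (Fin n)) : NodeState n where
  id := s.id
  lab := fun u => if u = s.id then s.rest + ∑ x ∈ I, s.lab x else if u ∈ I then 0 else s.lab u
  dirty := s.dirty || decide I.Nonempty
  phase := s.phase
  heard := fun u => if u ∈ I then none else s.heard u

open scoped Classical in
/-- The state after the messages `m` have been received. -/
noncomputable def update (s : NodeState n) (m : Fin n → Option (Bool × ℕ)) : NodeState n :=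
  if s.phase then
    { id := s.id
      lab := fun u => if u = s.id then s.rest - ∑ x, gain s m x else s.lab u + gain s m u
      dirty := s.dirty && !decide (Repairs s m)
      phase := false
      heard := fun _ => none }
  else { s with phase := true, heard := m }

end DualRepair

open DualRepair in
/-- The algorithm that repairs, in every odd round, the stars of the dirty nodes that are granted
permission by all their neighbours. -/
noncomputable def dualRepair (n : ℕ) : DynamicAlgorithm n where
  State := NodeState n
  init := start
  observe := fun s _ I => observe s I
  send := fun s u => encodeMessage (content s u)
  receive := fun s m => update s fun u => (m u).map decodeMessage
  label := fun s u => s.lab u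

namespace DualRepair

variable {n : ℕ} {w : Fin n → ℕ} {G H : SimpleGraph (Fin n)} {σ : Fin n → NodeState n}

/-! ### Grants and shares -/

theorem Grants.unique {s : NodeState n} {u v : Fin n} (hu : Grants s u) (hv : Grants s v) :
    u = v :=
  le_antisymm (hu.2 v hv.1) (hv.2 u hu.1)

theorem share_eq_zero {s : NodeState n} (h : ¬ Grants s s.id) (u : Fin n) : share s u = 0 :=
  if_neg h

theorem share_le_demand (s : NodeState n) (u : Fin n) : share s u ≤ demand s u := by
  unfold share
  split_ifs
  exacts [greedyShare_le _ _ _, Nat.zero_le _]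

theorem sum_share_le (s : NodeState n) : ∑ u, share s u ≤ s.rest := by
  unfold share
  split_ifs
  exacts [sum_greedyShare_le _ _, by simp]

/-- This controls the message length: the number sent never exceeds the remaining weight, and hence
not the weight of the sender. -/
theorem content_snd_le (s : NodeState n) (u : Fin n) : (content s u).2 ≤ s.rest := by
  unfold content
  split_ifs
  · exact (Finset.single_le_sum (f := share s) (fun _ _ => Nat.zero_le _)
      (Finset.mem_univ u)).trans (sum_share_le s)
  · exact le_rfl

/-! ### The invariant -/

/-- The announcements that the nodes remember: they were made over the edges of a subgraph of `G`,
and are outdated only if the sender has become dirty. -/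
def HeardValid (G : SimpleGraph (Fin n)) (σ : Fin n → NodeState n) : Prop :=
  ∃ (F : SimpleGraph (Fin n)) (d : Fin n → Bool) (r : Fin n → ℕ), F ≤ G ∧
    (∀ v u, F.Adj v u → (σ v).heard u = some (d u, r u)) ∧
    (∀ v u, ¬ F.Adj v u → (σ v).heard u = none) ∧
    ∀ u, (d u = true → (σ u).dirty = true) ∧ r u ≤ (σ u).rest ∧
      (r u = (σ u).rest ∨ (σ u).dirty = true)

/-- The invariant of the algorithm. -/
structure Invariant (w : Fin n → ℕ) (G : SimpleGraph (Fin n)) (b : Bool)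
    (σ : Fin n → NodeState n) : Prop where
  id_eq : ∀ v, (σ v).id = v
  phase_eq : ∀ v, (σ v).phase = b
  eq_zero_of_not_adj : ∀ v u, u ≠ v → ¬ G.Adj v u → (σ v).lab u = 0
  symm : ∀ v u, G.Adj v u → (σ v).lab u = (σ u).lab v
  sum_eq : ∀ v, ∑ u, (σ v).lab u = w v
  covered : ∀ v u, G.Adj v u → (σ v).dirty = true ∨ (σ u).dirty = true ∨
    (σ v).rest = 0 ∨ (σ u).rest = 0
  heard : HeardValid G σ

theorem Invariant.rest_eq {b : Bool} (h : Invariant w G b σ) (v : Fin n) :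
    (σ v).rest = (σ v).lab v := by
  rw [NodeState.rest, h.id_eq]

theorem Invariant.rest_le {b : Bool} (h : Invariant w G b σ) (v : Fin n) : (σ v).rest ≤ w v := by
  rw [← h.sum_eq v]
  exact Finset.single_le_sum (f := (σ v).lab) (fun _ _ => Nat.zero_le _) (Finset.mem_univ _)

theorem Invariant.labelingConsistent {b : Bool} (h : Invariant w G b σ)
    (hd : ∀ v, (σ v).dirty = false) :
    LabelingConsistent G (fun v => (w v : ℝ)) (fun v u => ((σ v).lab u : ℝ)) := fun v =>
  { nonneg := fun u => Nat.cast_nonneg _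
    eq_zero_of_not_adj := fun u hu ha => by simp [h.eq_zero_of_not_adj v u hu ha]
    sum_eq := by
      rw [← h.sum_eq v, Nat.cast_sum]
    reciprocal := fun u ha => by rw [h.symm v u ha]
    covered := by
      by_cases hv : (σ v).rest = 0
      · left
        rw [← h.rest_eq, hv, Nat.cast_zero]
      · right
        intro u hu
        have := h.covered v u hu
        simp only [hd, hv, Bool.false_eq_true, false_or] at this
        rw [← h.rest_eq, this, Nat.cast_zero] }

theorem invariant_start (w : Fin n → ℕ) : Invariant w ⊥ false (fun v => start v (w v)) where
  id_eq := fun _ => rfl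
  phase_eq := fun _ => rfl
  eq_zero_of_not_adj := fun v u hu _ => if_neg hu
  symm := fun v u h => h.elim
  sum_eq := fun v => by simp [start]
  covered := fun v u h => h.elim
  heard := ⟨⊥, fun _ => false, fun u => (start u (w u)).rest, le_rfl, fun _ _ h => h.elim,
    fun _ _ _ => rfl, fun _ => ⟨fun h => by simp at h, le_rfl, Or.inl rfl⟩⟩

/-! ### Preservation of the invariant under topology changes -/

theorem observe_empty (s : NodeState n) : observe s ∅ = s := by
  cases s
  simp only [observe, NodeState.rest, NodeState.mk.injEq, true_and]
  refine ⟨?_, by simp, by simp⟩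
  ext u
  simp only [Finset.sum_empty, add_zero, Finset.notMem_empty, if_false]
  split_ifs with h
  exacts [congrArg _ h.symm, rfl]

theorem rest_observe (s : NodeState n) (I : Finset (Fin n)) :
    (observe s I).rest = s.rest + ∑ x ∈ I, s.lab x := by
  simp [observe, NodeState.rest]

/-- Weight only moves from changed edges back to their endpoints, so the sums are conserved. The
indications are symmetric, so both endpoints of a changed edge reset its label and become dirty; a
node without indications is untouched. -/
theorem Invariant.observe {b : Bool} (h : Invariant w H b σ) {I : Fin n → Finset (Fin n)}
    (hI : ∀ v u, u ∈ I v ↔ ¬ (H.Adj v u ↔ G.Adj v u)) :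
    Invariant w G b (fun v => observe (σ v) (I v)) := by
  have hself : ∀ v, v ∉ I v := fun v => by simp [hI]
  have hIsymm : ∀ v u, u ∈ I v ↔ v ∈ I u := fun v u => by
    rw [hI, hI, H.adj_comm, G.adj_comm]
  have hdirty : ∀ v u, u ∈ I v → (DualRepair.observe (σ v) (I v)).dirty = true := fun v u hu => by
    have : (I v).Nonempty := ⟨u, hu⟩
    simp [DualRepair.observe, this]
  have hdirty' : ∀ v, (σ v).dirty = true → (DualRepair.observe (σ v) (I v)).dirty = true :=
    fun v hv => by simp [DualRepair.observe, hv]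
  have hrest : ∀ v, (σ v).rest = (DualRepair.observe (σ v) (I v)).rest ∨
      (DualRepair.observe (σ v) (I v)).dirty = true := fun v => by
    rcases (I v).eq_empty_or_nonempty with he | ⟨u, hu⟩
    · left
      rw [he, observe_empty]
    · exact Or.inr (hdirty v u hu)
  have hlab : ∀ v u, u ≠ v → (DualRepair.observe (σ v) (I v)).lab u =
      if u ∈ I v then 0 else (σ v).lab u := fun v u huv => by
    simp only [DualRepair.observe, h.id_eq, if_neg huv]
  refine ⟨h.id_eq, h.phase_eq, fun v u huv ha => ?_, fun v u ha => ?_, fun v => ?_,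
    fun v u ha => ?_, ?_⟩
  · rw [hlab v u huv]
    split_ifs with hu
    · rfl
    · rw [hI, not_not] at hu
      exact h.eq_zero_of_not_adj v u huv (hu.not.2 ha)
  · rw [hlab v u ha.ne', hlab u v ha.ne, if_congr (hIsymm u v) rfl rfl]
    split_ifs with hu
    · rfl
    · rw [hI, not_not] at hu
      exact h.symm v u (hu.2 ha)
  · rw [← h.sum_eq v, ← Finset.add_sum_erase _ _ (Finset.mem_univ v),
      ← Finset.add_sum_erase _ (σ v).lab (Finset.mem_univ v),
      Finset.sum_congr rfl fun u hu => hlab v u (Finset.ne_of_mem_erase hu)]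
    have h1 : (DualRepair.observe (σ v) (I v)).lab v = (σ v).lab v + ∑ x ∈ I v, (σ v).lab x := by
      have := rest_observe (σ v) (I v)
      rwa [h.rest_eq, NodeState.rest, show (DualRepair.observe (σ v) (I v)).id = v from h.id_eq v]
        at this
    have h2 : ∑ x ∈ I v, (σ v).lab x =
        ∑ u ∈ Finset.univ.erase v, if u ∈ I v then (σ v).lab u else 0 := by
      rw [← Finset.sum_filter]
      refine Finset.sum_congr ?_ fun _ _ => rfl
      ext u
      simp only [Finset.mem_filter, Finset.mem_erase, Finset.mem_univ, and_true]
      exact ⟨fun hu => ⟨fun huv => hself v (huv ▸ hu), hu⟩, fun hu => hu.2⟩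
    rw [h1, h2, add_assoc, ← Finset.sum_add_distrib]
    congr 1
    refine Finset.sum_congr rfl fun u _ => ?_
    split_ifs <;> simp
  · by_cases hu : u ∈ I v
    · exact Or.inl (hdirty v u hu)
    · rw [hI, not_not] at hu
      rcases h.covered v u (hu.2 ha) with h1 | h1 | h1 | h1
      · exact Or.inl (hdirty' v h1)
      · exact Or.inr (Or.inl (hdirty' u h1))
      · rcases hrest v with h2 | h2
        · exact Or.inr (Or.inr (Or.inl (h2.symm.trans h1)))
        · exact Or.inl h2
      · rcases hrest u with h2 | h2
        · exact Or.inr (Or.inr (Or.inr (h2.symm.trans h1)))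
        · exact Or.inr (Or.inl h2)
  · obtain ⟨F, d, r, hF, hs, hn, hdr⟩ := h.heard
    -- An edge of `F` lies in the old graph `H`, so it is unchanged exactly if it also lies in `G`.
    -- The announced values stay the same, although the actual ones may have grown.
    refine ⟨F ⊓ G, d, r, inf_le_right, fun v u hvu => ?_, fun v u hvu => ?_, fun u => ⟨?_, ?_, ?_⟩⟩
    · have hu : u ∉ I v := by
        rw [hI, not_not]
        exact iff_of_true (hF hvu.1) hvu.2
      simp only [DualRepair.observe, if_neg hu, hs v u hvu.1]
    · simp only [DualRepair.observe]
      split_ifs with hu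
      · rfl
      · rw [hI, not_not] at hu
        exact hn v u fun hFvu => hvu ⟨hFvu, hu.1 (hF hFvu)⟩
    · exact fun hd => hdirty' u ((hdr u).1 hd)
    · rw [rest_observe]
      exact (hdr u).2.1.trans (Nat.le_add_right _ _)
    · rcases (hdr u).2.2 with h1 | h1
      · rcases hrest u with h2 | h2
        exacts [Or.inl (h1.trans h2), Or.inr h2]
      · exact Or.inr (hdirty' u h1)

/-! ### Preservation of the invariant under an exchange of messages -/

open scoped Classical in
/-- The contents of the messages that `v` receives in graph `G`. -/
noncomputable def inbox (G : SimpleGraph (Fin n)) (σ : Fin n → NodeState n) (v : Fin n) :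
    Fin n → Option (Bool × ℕ) :=
  fun u => if G.Adj u v then some (content (σ u) v) else none

/-- The states after one exchange of messages. -/
noncomputable def exchange (G : SimpleGraph (Fin n)) (σ : Fin n → NodeState n) (v : Fin n) :
    NodeState n :=
  update (σ v) (inbox G σ v)

theorem exchange_of_phase_false (h : Invariant w G false σ) (v : Fin n) :
    exchange G σ v = { σ v with phase := true, heard := inbox G σ v } := by
  simp [exchange, update, h.phase_eq]

theorem Invariant.exchange_false (h : Invariant w G false σ) :
    Invariant w G true (exchange G σ) := by
  have hx : exchange G σ = fun v => { σ v with phase := true, heard := inbox G σ v } :=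
    funext (exchange_of_phase_false h)
  rw [hx]
  refine ⟨h.id_eq, fun _ => rfl, h.eq_zero_of_not_adj, h.symm, h.sum_eq, h.covered, ?_⟩
  refine ⟨G, fun u => (σ u).dirty, fun u => (σ u).rest, le_rfl, fun v u hvu => ?_,
    fun v u hvu => ?_, fun u => ⟨id, le_rfl, Or.inl rfl⟩⟩
  · simp [inbox, hvu.symm, content, h.phase_eq]
  · simp [inbox, G.adj_comm u v, hvu]

/-- Offers are bounded by announced remaining weights, and an outdated announcement can only be too
small. -/
theorem Invariant.share_le_rest {b : Bool} (h : Invariant w G b σ) (v u : Fin n) :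
    share (σ u) v ≤ (σ v).rest := by
  obtain ⟨F, d, r, hF, hs, hn, hdr⟩ := h.heard
  refine (share_le_demand _ _).trans ?_
  by_cases ha : F.Adj u v
  · simp only [demand, hs u v ha]
    exact (hdr v).2.1
  · simp [demand, hn u v ha]

open scoped Classical in
theorem gain_inbox (h : Invariant w G true σ) (v u : Fin n) :
    gain (σ v) (inbox G σ v) u = if G.Adj v u then
      (if Grants (σ u) v then share (σ v) u else 0) + (if Grants (σ v) u then share (σ u) v else 0)
      else 0 := by
  simp only [gain, inbox, G.adj_comm u v]
  split_ifs <;> simp_all [content, h.phase_eq]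

/-- The two summands of the gain swap roles when the endpoints are swapped, so both endpoints raise
the edge by the same amount. -/
theorem gain_symm (h : Invariant w G true σ) (v u : Fin n) :
    gain (σ v) (inbox G σ v) u = gain (σ u) (inbox G σ u) v := by
  rw [gain_inbox h, gain_inbox h, G.adj_comm, add_comm]

open scoped Classical in
theorem gain_of_grants (h : Invariant w G true σ) {v : Fin n} (hv : Grants (σ v) v) (u : Fin n) :
    gain (σ v) (inbox G σ v) u = if G.Adj v u ∧ Grants (σ u) v then share (σ v) u else 0 := by
  rw [gain_inbox h, ite_and]
  refine if_ctx_congr Iff.rfl (fun ha => ?_) fun _ => rfl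
  rw [if_neg fun hu : Grants (σ v) u => ha.ne (hv.unique hu), add_zero]

/-- A node grants at most one node. If that is itself, it accepts no foreign offers and spends only
its own shares, which fit its budget. Otherwise it offers nothing and accepts at most one offer,
which was limited by its demand. -/
theorem sum_gain_le (h : Invariant w G true σ) (v : Fin n) :
    ∑ u, gain (σ v) (inbox G σ v) u ≤ (σ v).rest := by
  classical
  by_cases hv : Grants (σ v) v
  · refine le_trans (Finset.sum_le_sum fun u _ => ?_) (sum_share_le (σ v))
    rw [gain_of_grants h hv]
    split_ifs
    exacts [le_rfl, Nat.zero_le _]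
  · have hg : ∀ u, gain (σ v) (inbox G σ v) u ≤ if Grants (σ v) u then share (σ u) v else 0 := by
      intro u
      rw [gain_inbox h, share_eq_zero (by rwa [h.id_eq])]
      split_ifs <;> simp
    refine (Finset.sum_le_sum fun u _ => hg u).trans ?_
    by_cases hu : ∃ u, Grants (σ v) u
    · obtain ⟨u, hu⟩ := hu
      rw [Finset.sum_eq_single u (fun x _ hx => if_neg fun hx' => hx (hx'.unique hu))
        (fun h' => absurd (Finset.mem_univ u) h'), if_pos hu]
      exact h.share_le_rest v u
    · push Not at hu
      simp [hu]

theorem id_exchange (h : Invariant w G true σ) (v : Fin n) : (exchange G σ v).id = v := by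
  simp [exchange, update, h.phase_eq, h.id_eq]

theorem lab_exchange (h : Invariant w G true σ) {v u : Fin n} (huv : u ≠ v) :
    (exchange G σ v).lab u = (σ v).lab u + gain (σ v) (inbox G σ v) u := by
  simp [exchange, update, h.phase_eq, h.id_eq, huv]

theorem rest_exchange (h : Invariant w G true σ) (v : Fin n) :
    (exchange G σ v).rest = (σ v).rest - ∑ u, gain (σ v) (inbox G σ v) u := by
  simp [exchange, update, h.phase_eq, NodeState.rest]

theorem dirty_exchange (h : Invariant w G true σ) (v : Fin n) :
    (exchange G σ v).dirty = true ↔ (σ v).dirty = true ∧ ¬ Repairs (σ v) (inbox G σ v) := by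
  simp [exchange, update, h.phase_eq]

theorem repairs_inbox (h : Invariant w G true σ) (v : Fin n) :
    Repairs (σ v) (inbox G σ v) ↔
      Grants (σ v) v ∧ ∀ u, G.Adj v u → Grants (σ u) v := by
  unfold Repairs
  rw [h.id_eq]
  refine and_congr_right fun _ => forall_congr' fun u => ?_
  by_cases ha : G.Adj v u <;>
    simp [inbox, G.adj_comm u v, ha, content, h.phase_eq]

/-- All offers of `v` are accepted. Either they use up its remaining weight, or the greedy
allocation meets every demand. In the latter case `u` receives its announced remaining weight, which
exhausts it unless `u` is dirty; and then `u` stays dirty, since its grant went to `v` and not to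
itself. -/
theorem rest_exchange_of_repairs (h : Invariant w G true σ) {v u : Fin n} (ha : G.Adj v u)
    (hv : Repairs (σ v) (inbox G σ v)) :
    (exchange G σ v).rest = 0 ∨ (exchange G σ u).rest = 0 ∨
      (exchange G σ u).dirty = true := by
  obtain ⟨hvv, hnb⟩ := (repairs_inbox h v).1 hv
  obtain ⟨F, d, r, hF, hs, hn, hdr⟩ := h.heard
  have hgain : ∀ x, gain (σ v) (inbox G σ v) x = share (σ v) x := fun x => by
    rw [gain_of_grants h hvv]
    split_ifs with hx
    · rfl
    · have hx' : ¬ F.Adj v x := fun hF' => hx ⟨hF hF', hnb x (hF hF')⟩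
      have := share_le_demand (σ v) x
      rw [demand, hn v x hx'] at this
      exact (Nat.le_zero.1 this).symm
  have hshare : ∀ x, share (σ v) x = greedyShare (demand (σ v)) (σ v).rest x := fun x =>
    if_pos (by rwa [h.id_eq])
  rcases (sum_share_le (σ v)).eq_or_lt with heq | hlt
  · left
    rw [rest_exchange h, Finset.sum_congr rfl fun x _ => hgain x, heq, Nat.sub_self]
  · right
    simp only [hshare] at hlt
    have huv : Grants (σ u) v := hnb u ha
    -- Since `u` grants `v ≠ u`, it has heard `v`; as `F` is symmetric, `v` has heard `u` too and
    -- knows its demand.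
    have hFvu : F.Adj v u := by
      rcases huv.1 with ⟨h1, -⟩ | ⟨k, hk⟩
      · exact absurd (h1.trans (h.id_eq u)) ha.ne
      · by_contra hF'
        simp [hn u v fun h' => hF' h'.symm] at hk
    have hguv : gain (σ u) (inbox G σ u) v = r u := by
      rw [← gain_symm h, hgain, hshare, greedyShare_eq_of_sum_lt hlt, demand, hs v u hFvu]
      rfl
    rcases (hdr u).2.2 with h1 | h1
    · left
      rw [rest_exchange h, Nat.sub_eq_zero_iff_le, ← h1, ← hguv]
      exact Finset.single_le_sum (f := gain (σ u) (inbox G σ u)) (fun _ _ => Nat.zero_le _)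
        (Finset.mem_univ v)
    · right
      rw [dirty_exchange h]
      exact ⟨h1, fun hu => ha.ne (huv.unique ((repairs_inbox h u).1 hu).1)⟩

theorem Invariant.exchange_true (h : Invariant w G true σ) :
    Invariant w G false (exchange G σ) := by
  have hzero : ∀ v u, ¬ G.Adj v u → gain (σ v) (inbox G σ v) u = 0 := fun v u ha => by
    rw [gain_inbox h, if_neg ha]
  have hrest0 : ∀ v, (σ v).rest = 0 → (exchange G σ v).rest = 0 := fun v hv => by
    rw [rest_exchange h, hv, Nat.zero_sub]
  have hcov : ∀ v u, G.Adj v u → (σ v).dirty = true → (exchange G σ v).dirty = true ∨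
      (exchange G σ u).dirty = true ∨ (exchange G σ v).rest = 0 ∨ (exchange G σ u).rest = 0 := by
    intro v u ha hd
    by_cases hr : Repairs (σ v) (inbox G σ v)
    · have := rest_exchange_of_repairs h ha hr
      tauto
    · exact Or.inl ((dirty_exchange h v).2 ⟨hd, hr⟩)
  refine ⟨id_exchange h, fun v => ?_, fun v u huv ha => ?_, fun v u ha => ?_, fun v => ?_,
    fun v u ha => ?_, ?_⟩
  · simp [exchange, update, h.phase_eq]
  · rw [lab_exchange h huv, h.eq_zero_of_not_adj v u huv ha, hzero v u ha]
  · rw [lab_exchange h ha.ne', lab_exchange h ha.ne, h.symm v u ha, gain_symm h]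
  · have h1 : (exchange G σ v).lab v = (σ v).lab v - ∑ u, gain (σ v) (inbox G σ v) u := by
      have := rest_exchange h v
      rwa [h.rest_eq, NodeState.rest, id_exchange h] at this
    -- This bound keeps the natural subtraction in the remaining weight from truncating, so that the
    -- sum of the label is conserved.
    have h2 := sum_gain_le h v
    have h3 : ∑ u, gain (σ v) (inbox G σ v) u =
        ∑ u ∈ Finset.univ.erase v, gain (σ v) (inbox G σ v) u := by
      rw [← Finset.add_sum_erase _ _ (Finset.mem_univ v), hzero v v (G.loopless.irrefl v), zero_add]
    rw [h.rest_eq] at h2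
    rw [← h.sum_eq v, ← Finset.add_sum_erase _ _ (Finset.mem_univ v),
      ← Finset.add_sum_erase _ (σ v).lab (Finset.mem_univ v),
      Finset.sum_congr rfl fun u hu => lab_exchange h (Finset.ne_of_mem_erase hu),
      Finset.sum_add_distrib, h1]
    omega
  · rcases h.covered v u ha with h1 | h1 | h1 | h1
    · exact hcov v u ha h1
    · have := hcov u v ha.symm h1
      tauto
    · exact Or.inr (Or.inr (Or.inl (hrest0 v h1)))
    · exact Or.inr (Or.inr (Or.inr (hrest0 u h1)))
  · refine ⟨⊥, fun u => (exchange G σ u).dirty, fun u => (exchange G σ u).rest, bot_le,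
      fun _ _ h' => h'.elim, fun v u _ => ?_, fun u => ⟨id, le_rfl, Or.inl rfl⟩⟩
    simp [exchange, update, h.phase_eq]

theorem Invariant.exchange {b : Bool} (h : Invariant w G b σ) :
    Invariant w G (!b) (exchange G σ) := by
  cases b
  exacts [h.exchange_false, h.exchange_true]

theorem dirty_of_dirty_exchange {b : Bool} (h : Invariant w G b σ) {v : Fin n}
    (hv : (DualRepair.exchange G σ v).dirty = true) : (σ v).dirty = true := by
  cases b
  · rwa [exchange_of_phase_false h] at hv
  · exact ((dirty_exchange h v).1 hv).1

/-! ### Progress in rounds without changes -/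

/-- All nodes have heard the current announcements of all their neighbours, and nothing else. -/
def HeardAll (G : SimpleGraph (Fin n)) (σ : Fin n → NodeState n) : Prop :=
  ∀ v u, (G.Adj v u → (σ v).heard u = some ((σ u).dirty, (σ u).rest)) ∧
    (¬ G.Adj v u → (σ v).heard u = none)

theorem heardAll_exchange (h : Invariant w G false σ) : HeardAll G (DualRepair.exchange G σ) := by
  intro v u
  rw [exchange_of_phase_false h, exchange_of_phase_false h]
  refine ⟨fun ha => ?_, fun ha => ?_⟩
  · simp [inbox, ha.symm, content, h.phase_eq, NodeState.rest]
  · simp [inbox, G.adj_comm u v, ha]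

/-- The smallest dirty node repairs its star. -/
theorem repairs_of_forall_le (h : Invariant w G true σ) (hh : HeardAll G σ) {v : Fin n}
    (hv : (σ v).dirty = true) (hmin : ∀ u, (σ u).dirty = true → v ≤ u) :
    Repairs (σ v) (inbox G σ v) := by
  -- With current announcements every node that asks is really dirty, so the global minimum wins at
  -- all nodes that know of it.
  have hasks : ∀ u x, Asks (σ u) x → v ≤ x := by
    rintro u x (⟨rfl, hd⟩ | ⟨k, hk⟩)
    · rw [h.id_eq]
      exact hmin u hd
    · by_cases ha : G.Adj u x
      · rw [(hh u x).1 ha] at hk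
        exact hmin x (by simpa using congrArg (Option.map Prod.fst) hk)
      · simp [(hh u x).2 ha] at hk
  rw [repairs_inbox h]
  exact ⟨⟨Or.inl ⟨(h.id_eq v).symm, hv⟩, hasks v⟩, fun u ha =>
    ⟨Or.inr ⟨(σ v).rest, by rw [(hh u v).1 ha.symm, hv]⟩, hasks u⟩⟩

/-- The set of dirty nodes. -/
def dirtySet (σ : Fin n → NodeState n) : Finset (Fin n) :=
  Finset.univ.filter fun v => (σ v).dirty = true

theorem mem_dirtySet {v : Fin n} : v ∈ dirtySet σ ↔ (σ v).dirty = true := by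
  simp [dirtySet]

theorem dirtySet_exchange_subset {b : Bool} (h : Invariant w G b σ) :
    dirtySet (DualRepair.exchange G σ) ⊆ dirtySet σ := fun _ hv =>
  mem_dirtySet.2 (dirty_of_dirty_exchange h (mem_dirtySet.1 hv))

theorem card_dirtySet_exchange_lt (h : Invariant w G true σ) (hh : HeardAll G σ)
    (hne : (dirtySet σ).Nonempty) :
    (dirtySet (DualRepair.exchange G σ)).card < (dirtySet σ).card := by
  refine Finset.card_lt_card ((Finset.ssubset_iff_of_subset (dirtySet_exchange_subset h)).2
    ⟨(dirtySet σ).min' hne, Finset.min'_mem _ _, fun hm => ?_⟩)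
  refine ((dirty_exchange h _).1 (mem_dirtySet.1 hm)).2 (repairs_of_forall_le h hh ?_ ?_)
  · exact mem_dirtySet.1 (Finset.min'_mem _ hne)
  · exact fun u hu => Finset.min'_le _ _ (mem_dirtySet.2 hu)

end DualRepair

/-! ### Executions and amortization -/

namespace DualRepair

variable {n : ℕ} (w : Fin n → ℕ) (G : ℕ → SimpleGraph (Fin n))

/-- The states of the nodes at the beginning of round `i`. -/
noncomputable def run (i : ℕ) : Fin n → NodeState n :=
  (dualRepair n).state w G i

/-- The states of the nodes in round `i` after the indications. -/
noncomputable def runObserved (i : ℕ) (v : Fin n) : NodeState n :=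
  observe (run w G i v) (indications G i v)

theorem run_succ (i : ℕ) : run w G (i + 1) = exchange (G i) (runObserved w G i) := by
  funext v
  change update (runObserved w G i v) _ = update (runObserved w G i v) _
  congr 1
  funext u
  by_cases ha : (G i).Adj u v
  · simp only [inbox, if_pos ha, Option.map_some]
    exact congrArg some (decodeMessage_encodeMessage _)
  · simp only [inbox, if_neg ha, Option.map_none]

theorem mem_indications (i : ℕ) (v u : Fin n) :
    u ∈ indications G i v ↔ ¬ ((graphBefore G i).Adj v u ↔ (G i).Adj v u) := by
  classical
  rw [indications, Finset.mem_filter, changedEdges, Set.mem_symmDiff, SimpleGraph.mem_edgeSet,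
    SimpleGraph.mem_edgeSet]
  simp only [Finset.mem_univ, true_and]
  tauto

theorem invariant_run (i : ℕ) : Invariant w (graphBefore G i) i.bodd (run w G i) := by
  induction i with
  | zero => exact invariant_start w
  | succ i ih =>
    rw [run_succ, Nat.bodd_succ]
    exact (ih.observe (mem_indications G i)).exchange

theorem invariant_runObserved (i : ℕ) : Invariant w (G i) i.bodd (runObserved w G i) :=
  (invariant_run w G i).observe (mem_indications G i)

variable {G} in
theorem graphBefore_eq {i : ℕ} (hc : (changedEdges G i).ncard = 0) : graphBefore G i = G i := by
  rw [Set.ncard_eq_zero (Set.toFinite _), changedEdges, ← Set.bot_eq_empty, symmDiff_eq_bot] at hc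
  exact SimpleGraph.edgeSet_injective hc

variable {G} in
theorem runObserved_eq {i : ℕ} (hc : (changedEdges G i).ncard = 0) :
    runObserved w G i = run w G i := by
  funext v
  have : indications G i v = ∅ := by
    ext u
    simp [mem_indications, graphBefore_eq hc]
  rw [runObserved, this, observe_empty]

variable {w G} in
theorem consistentAt_of_dirtySet_eq_empty {i : ℕ} (hc : (changedEdges G i).ncard = 0)
    (hd : dirtySet (run w G i) = ∅) : (dualRepair n).ConsistentAt w G i := by
  have h := invariant_run w G i
  rw [graphBefore_eq hc] at h
  refine h.labelingConsistent fun v => ?_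
  have : v ∉ dirtySet (run w G i) := by simp [hd]
  simpa [mem_dirtySet] using this

/-- Newly dirty nodes are endpoints of changed edges, at most two for each. -/
theorem card_dirtySet_runObserved_le (i : ℕ) :
    (dirtySet (runObserved w G i)).card ≤
      (dirtySet (run w G i)).card + 2 * (changedEdges G i).ncard := by
  classical
  have hfin : (changedEdges G i).Finite := Set.toFinite _
  have hsub : dirtySet (runObserved w G i) ⊆
      dirtySet (run w G i) ∪ hfin.toFinset.biUnion Sym2.toFinset := by
    intro v hv
    rw [mem_dirtySet] at hv
    rw [Finset.mem_union, mem_dirtySet, Finset.mem_biUnion]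
    simp only [runObserved, observe, Bool.or_eq_true, decide_eq_true_eq] at hv
    refine hv.imp id ?_
    rintro ⟨u, hu⟩
    exact ⟨s(v, u), by simpa [indications] using hu, by simp⟩
  refine (Finset.card_le_card hsub).trans ((Finset.card_union_le _ _).trans ?_)
  gcongr
  rw [Set.ncard_eq_toFinset_card _ hfin, mul_comm]
  refine Finset.card_biUnion_le_card_mul _ _ _ fun e _ => ?_
  rw [Sym2.card_toFinset]
  split_ifs <;> norm_num

theorem card_dirtySet_run_succ_le (i : ℕ) :
    (dirtySet (run w G (i + 1))).card ≤
      (dirtySet (run w G i)).card + 2 * (changedEdges G i).ncard := by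
  rw [run_succ]
  exact (Finset.card_le_card (dirtySet_exchange_subset (invariant_runObserved w G i))).trans
    (card_dirtySet_runObserved_le w G i)

variable {w G} in
-- Only round `i` itself must be free of changes. Changes in the preceding even round precede its
-- announcements, which are therefore still current in round `i`.
theorem card_dirtySet_run_succ_lt {i : ℕ} (hi : i.bodd = true)
    (hc : (changedEdges G i).ncard = 0) (hne : (dirtySet (run w G i)).Nonempty) :
    (dirtySet (run w G (i + 1))).card < (dirtySet (run w G i)).card := by
  obtain ⟨j, rfl⟩ : ∃ j, i = j + 1 := ⟨i - 1, by cases i <;> simp_all⟩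
  have h := invariant_runObserved w G (j + 1)
  have h' := invariant_runObserved w G j
  rw [hi, runObserved_eq w hc] at h
  rw [show j.bodd = false by simpa using hi] at h'
  rw [run_succ w G (j + 1), runObserved_eq w hc]
  refine card_dirtySet_exchange_lt h ?_ hne
  rw [← graphBefore_eq hc, run_succ]
  exact heardAll_exchange h'

/-- The potential at the beginning of round `i`: an upper bound for the number of the following
inconsistent rounds if no further changes occur. -/
noncomputable def potential (i : ℕ) : ℕ :=
  2 * (dirtySet (run w G i)).card - if i.bodd then 1 else 0

open scoped Classical in
-- Without changes, an inconsistent round lowers the potential by at least one: an even round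
-- through the parity term, an odd round because a dirty node is repaired, which costs two and gives
-- back the parity term.
theorem ite_add_potential_succ_le (i : ℕ) :
    (if (dualRepair n).ConsistentAt w G i then 0 else 1) + potential w G (i + 1) ≤
      potential w G i + 6 * (changedEdges G i).ncard := by
  have h1 := card_dirtySet_run_succ_le w G i
  have h2 : (if (dualRepair n).ConsistentAt w G i then 0 else 1) ≤ 1 := by
    split_ifs <;> norm_num
  unfold potential
  rw [Nat.bodd_succ]
  rcases Nat.eq_zero_or_pos (changedEdges G i).ncard with hc | hc
  · rcases (dirtySet (run w G i)).eq_empty_or_nonempty with hd | hd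
    · rw [if_pos (consistentAt_of_dirtySet_eq_empty hc hd)]
      rw [hd, Finset.card_empty] at h1 ⊢
      omega
    · have := hd.card_pos
      cases hi : i.bodd
      · simp
        omega
      · have h3 := card_dirtySet_run_succ_lt hi hc hd
        simp
        omega
  -- Each change raises the potential by at most four through its two endpoints. The other two cover
  -- the inconsistent round itself and the loss of the parity term, as there is at least one change.
  · cases hi : i.bodd <;> simp <;> omega

/-- The one-round inequality is summed; the potential starts at zero because no node is dirty
initially. -/
theorem incorrect_add_potential_le (i : ℕ) :
    (dualRepair n).incorrect w G i + potential w G (i + 1) ≤ 6 * changes G i := by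
  classical
  have key : ∀ k, (∑ j ∈ Finset.range k, if (dualRepair n).ConsistentAt w G j then 0 else 1) +
      potential w G k ≤ 6 * ∑ j ∈ Finset.range k, (changedEdges G j).ncard := by
    intro k
    induction k with
    | zero => simp [potential, dirtySet, run, DynamicAlgorithm.state, dualRepair, start]
    | succ k ih =>
      have := ite_add_potential_succ_le w G k
      rw [Finset.sum_range_succ, Finset.sum_range_succ]
      omega
  refine le_trans (le_of_eq ?_) (key (i + 1))
  congr 1
  rw [DynamicAlgorithm.incorrect, Finset.card_filter]
  refine Finset.sum_congr (by congr) fun j _ => ?_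
  split_ifs <;> simp_all

theorem length_message_le (i : ℕ) (u v : Fin n) {m : ℕ} (hm : w u ≤ m) :
    ((dualRepair n).message w G i u v).length ≤ m.size + 1 :=
  length_encodeMessage_le (x := content (runObserved w G i u) v)
    ((content_snd_le _ _).trans (((invariant_runObserved w G i).rest_le u).trans hm))

end DualRepair

open DualRepair in
theorem mainTheorem4 :
    ∃ (A : ∀ n : ℕ, DynamicAlgorithm n) (K : ℕ), ∀ p : Polynomial ℕ, ∃ B : ℕ,
      ∀ (n : ℕ) (w : Fin n → ℕ), (∀ v, 1 ≤ w v ∧ w v ≤ p.eval n) →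
      ∀ G : ℕ → SimpleGraph (Fin n),
        -- messages have `O(log n)` bits
        (∀ (i : ℕ) (u v : Fin n), (G i).Adj u v →
          ((A n).message w G i u v).length ≤ B * Nat.log 2 n) ∧
        -- the initial labelling is consistent for the initial, empty graph
        LabelingConsistent ⊥ (fun v => (w v : ℝ)) ((A n).labeling w G 0) ∧
        -- the amortized round complexity is at most `K`
        (∀ i : ℕ, 0 < changes G i →
          ((A n).incorrect w G i : ℝ) / (changes G i : ℝ) ≤ K) ∧
        -- in every consistent round the labels form a valid dual, whose tight nodes
        -- are the selected ones and are a 2-approximate minimum weight vertex cover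
        (∀ i : ℕ, (A n).ConsistentAt w G i →
          (∃ δ : Sym2 (Fin n) → ℝ,
            (∀ u v, (G i).Adj u v → δ s(u, v) = (A n).labeling w G i u v) ∧
            IsGValid (G i) (fun v => (w v : ℝ)) δ ∧
            tightNodes (G i) (fun v => (w v : ℝ)) δ = selectedNodes ((A n).labeling w G i)) ∧
          IsTwoApproxMWVC (G i) (fun v => (w v : ℝ))
            (selectedNodes ((A n).labeling w G i))) := by
  refine ⟨dualRepair, 6, fun p => ?_⟩
  obtain ⟨B, hB⟩ := exists_size_eval_le_mul_log p
  refine ⟨B, fun n w hw G => ⟨fun i u v huv => ?_, ?_, fun i hi => ?_, fun i hi => ?_⟩⟩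
  -- The sender and the receiver are distinct, which excludes the sizes at which the logarithm
  -- vanishes.
  · have hn : 2 ≤ n := by
      have := Fin.val_ne_of_ne huv.ne
      omega
    exact (length_message_le w G i u v (hw u).2).trans (hB n hn)
  · exact (invariant_start w).labelingConsistent fun _ => rfl
  · rw [div_le_iff₀ (by exact_mod_cast hi)]
    exact_mod_cast (Nat.le_add_right _ _).trans (incorrect_add_potential_le w G i)
  · exact ⟨⟨edgeWeight _, fun u v huv => LabelingConsistent.edgeWeight_mk hi huv.ne,
      LabelingConsistent.isGValid hi, LabelingConsistent.tightNodes_eq hi⟩,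
      LabelingConsistent.isTwoApproxMWVC hi⟩
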